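/- Definitions. Let $0\le\varepsilon<1$, $0<\delta<1$. A random matrix $\Omega\in\mathbb{R}^{l\times n}$ is an $(\varepsilon,\delta,d)$ oblivious subspace embedding (OSE) if for every fixed $d$-dimensional subspace $V\subseteq\mathbb{R}^n$, with probability at least $1-\delta$, $$\bigl|\,\|x\|_2^2-\|\Omega x\|_2^2\,\bigr|\le\varepsilon\|x\|_2^2\quad\text{for all }x\in V .$$ For $M\in\mathbb{R}^{n\times n}$, $[\![M]\!]_k$ denotes a truncated singular value decomposition of $M$, obtained from a singular value decomposition $M=U\Sigma V^{\mathrm T}$ (singular values in decreasing order) by keeping the $k$ largest singular values and replacing the others by $0$ (so $[\![M]\!]_k=M$ if $k\ge n$). $\|\cdot\|_2$ is the spectral norm, $\|\cdot\|_*$ the trace norm (sum of the singular values), and $\dagger$ the Moore–Penrose pseudo-inverse. Theorem. Let $A\in\mathbb{R}^{n\times n}$ be symmetric positive semidefinite, let $1\le d\le n$ and $k\ge 0$ be integers, let $0\le\varepsilon^*\le\frac12$, $0<\delta<1$, and put $\varepsilon=\frac49\varepsilon^*$ and $N=2nd+n+d$. Let $\Omega\in\mathbb{R}^{l\times n}$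 be a random matrix that is both a $(\frac13,\delta,d)$ OSE and a $\bigl(\sqrt{\varepsilon/d},\frac{\delta}{N},1\bigr)$ OSE. Let $$[\![A]\!]^{(\mathrm{Nyst})}=(\Omega A)^{\mathrm T}(\Omega A\Omega^{\mathrm T})^{\dagger}(\Omega A)$$ be the Nyström approximation and let $[\![A]\!]^{(\mathrm{Nyst})}_k=[\![\,[\![A]\!]^{(\mathrm{Nyst})}\,]\!]_k$ be its rank-$k$ truncation. Then, with probability at least $1-2\delta$, both of the following hold: $$\|A-[\![A]\!]^{(\mathrm{Nyst})}\|_*\le(1+\varepsilon^*)\,\|A-[\![A]\!]_d\|_*,$$ and, for $\xi=2$ and for $\xi=*$ and for every choice of the truncations, $$\|A-[\![A]\!]^{(\mathrm{Nyst})}_k\|_\xi\le\|A-[\![A]\!]_k\|_\xi+3\,\|A-[\![A]\!]_d\|_* .$$ -/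

import Mathlib

open MeasureTheory

namespace Sketch

/-- The random matrix `Ω`, with `l` rows and `n` columns, defined on the probability space `(S, P)`,
is an `(ε, δ, d)` oblivious subspace embedding. -/
structure IsOSE {S : Type*} [MeasurableSpace S] (P : Measure S) {l n : ℕ}
    (Ω : S → Matrix (Fin l) (Fin n) ℝ) (ε δ : ℝ) (d : ℕ) : Prop where
  eps_nonneg : 0 ≤ ε
  eps_lt_one : ε < 1
  delta_pos : 0 < δ
  delta_lt_one : δ < 1
  prob_le : ∀ V : Submodule ℝ (EuclideanSpace ℝ (Fin n)), Module.finrank ℝ V = d →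
    1 - δ ≤ P.real {s | ∀ x ∈ V, |‖x‖ ^ 2 - ‖Matrix.toEuclideanLin (Ω s) x‖ ^ 2| ≤ ε * ‖x‖ ^ 2}

/-- `B` is a rank-`k` truncated singular value decomposition of the square matrix `M`: for some
singular value decomposition `M = U Σ Vᵀ`, with `U`, `V` orthogonal and nonnegative singular values
in decreasing order, `B` is obtained by keeping the first `k` singular values. -/
def IsTruncatedSVD {n : ℕ} (k : ℕ) (M B : Matrix (Fin n) (Fin n) ℝ) : Prop :=
  ∃ U ∈ Matrix.orthogonalGroup (Fin n) ℝ, ∃ V ∈ Matrix.orthogonalGroup (Fin n) ℝ,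
    ∃ σ : Fin n → ℝ, Antitone σ ∧ (∀ i, 0 ≤ σ i) ∧
      M = U * Matrix.diagonal σ * V.transpose ∧
      B = U * Matrix.diagonal (fun i : Fin n => if (i : ℕ) < k then σ i else 0) * V.transpose

/-- Every square matrix has a truncated singular value decomposition. -/
theorem exists_isTruncatedSVD {n : ℕ} (k : ℕ) (M : Matrix (Fin n) (Fin n) ℝ) :
    ∃ B, IsTruncatedSVD k M B := by
  suffices h : ∃ U ∈ Matrix.orthogonalGroup (Fin n) ℝ, ∃ V ∈ Matrix.orthogonalGroup (Fin n) ℝ,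
      ∃ σ : Fin n → ℝ, Antitone σ ∧ (∀ i, 0 ≤ σ i) ∧ M = U * Matrix.diagonal σ * V.transpose by
    obtain ⟨U, hU, V, hV, σ, h1, h2, h3⟩ := h
    exact ⟨_, U, hU, V, hV, σ, h1, h2, h3, rfl⟩
  set T := Matrix.toEuclideanLin M with hT
  have hn : Module.finrank ℝ (EuclideanSpace ℝ (Fin n)) = n := by simp
  set v := T.isSymmetric_adjoint_comp_self.eigenvectorBasis hn with hv
  set σ : Fin n → ℝ := fun i => T.singularValues i with hσ
  have hTv : ∀ i j, inner ℝ (T (v i)) (T (v j)) = if i = j then σ j ^ 2 else 0 := by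
    intro i j
    have h2 : LinearMap.adjoint T (T (v j)) = (σ j ^ 2) • v j := by
      rw [T.sq_singularValues_fin hn j]
      exact T.isSymmetric_adjoint_comp_self.apply_eigenvectorBasis hn j
    rw [← LinearMap.adjoint_inner_right, h2, inner_smul_right,
      orthonormal_iff_ite.mp v.orthonormal i j]
    split_ifs <;> simp
  obtain ⟨u, hu⟩ := Orthonormal.exists_orthonormalBasis_extension_of_card_eq
    (𝕜 := ℝ) (ι := Fin n) (E := EuclideanSpace ℝ (Fin n)) (by simp)
    (v := fun i => (σ i)⁻¹ • T (v i)) (s := {i | σ i ≠ 0}) (by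
      rw [orthonormal_iff_ite]
      rintro ⟨i, hi⟩ ⟨j, hj⟩
      simp only [Set.mem_ofPred_eq] at hi hj
      simp only [Set.domRestrict_apply, inner_smul_left, inner_smul_right, hTv, Subtype.mk.injEq]
      split_ifs with h
      · subst h
        simp
        field_simp
      · simp)
  have hTu : ∀ i, T (v i) = σ i • u i := by
    intro i
    by_cases h : σ i = 0
    · have h3 := hTv i i
      rw [if_pos rfl, h] at h3
      rw [h, zero_smul]
      exact (inner_self_eq_zero (𝕜 := ℝ)).mp (by rw [h3]; norm_num)
    · rw [hu i h, smul_inv_smul₀ h]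
  have key : ∀ w : OrthonormalBasis (Fin n) ℝ (EuclideanSpace ℝ (Fin n)),
      (Matrix.of fun a i => w i a) ∈ Matrix.orthogonalGroup (Fin n) ℝ := by
    intro w
    rw [Matrix.mem_orthogonalGroup_iff']
    ext i j
    have := orthonormal_iff_ite.mp w.orthonormal j i
    simp only [PiLp.inner_apply] at this
    simp only [Matrix.mul_apply, Matrix.of_apply, Matrix.one_apply]
    simpa [eq_comm] using this
  refine ⟨_, key u, _, key v, σ, ?_, fun i => T.singularValues_nonneg i, ?_⟩
  · intro i j hij
    exact T.singularValues_antitone hij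
  · have hMV : M * (Matrix.of fun a i => v i a) =
        (Matrix.of fun a i => u i a) * Matrix.diagonal σ := by
      ext a i
      have := congrArg (fun x : EuclideanSpace ℝ (Fin n) => x a) (hTu i)
      simp only [hT, Matrix.toLpLin_apply, PiLp.smul_apply, smul_eq_mul,
        Matrix.mulVec, dotProduct] at this
      rw [Matrix.mul_diagonal, Matrix.of_apply, mul_comm, ← this, Matrix.mul_apply]
      rfl
    have hVV := (Matrix.mem_orthogonalGroup_iff (Fin n) ℝ).mp (key v)
    rw [← hMV, Matrix.mul_assoc]
    rw [hVV, Matrix.mul_one]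

/-- The four Penrose conditions: `X` is the Moore–Penrose inverse of `M`. -/
structure IsMoorePenrose {m n : ℕ} (M : Matrix (Fin m) (Fin n) ℝ)
    (X : Matrix (Fin n) (Fin m) ℝ) : Prop where
  mul_mul_left : M * X * M = M
  mul_mul_right : X * M * X = X
  symm_left : (M * X).transpose = M * X
  symm_right : (X * M).transpose = X * M

theorem exists_isMoorePenrose {m n : ℕ} (M : Matrix (Fin m) (Fin n) ℝ) :
    ∃ X, IsMoorePenrose M X := by
  obtain ⟨G, hG⟩ : ∃ G, G = M.transpose * M := ⟨_, rfl⟩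
  have hGt : G.transpose = G := by rw [hG]; simp
  obtain ⟨R, h1, h2, h3, h4⟩ : ∃ R : Matrix (Fin n) (Fin n) ℝ,
      G * R * G = G ∧ R * G * R = R ∧ R.transpose = R ∧ G * R = R * G := by
    have hH : G.IsHermitian := by
      rw [Matrix.IsHermitian, Matrix.conjTranspose_eq_transpose_of_trivial, hGt]
    obtain ⟨E, D, hE, hD⟩ : ∃ (E : Matrix (Fin n) (Fin n) ℝ) (D : Fin n → ℝ),
        E.transpose * E = 1 ∧ G = E * Matrix.diagonal D * E.transpose := by
      refine ⟨hH.eigenvectorUnitary, hH.eigenvalues, ?_, ?_⟩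
      · have := Unitary.coe_star_mul_self hH.eigenvectorUnitary
        rwa [Matrix.star_eq_conjTranspose, Matrix.conjTranspose_eq_transpose_of_trivial] at this
      · have := hH.spectral_theorem
        rw [Unitary.conjStarAlgAut_apply, Matrix.star_eq_conjTranspose,
          Matrix.conjTranspose_eq_transpose_of_trivial] at this
        exact this
    have hc : ∀ a b : Fin n → ℝ, (E * Matrix.diagonal a * E.transpose) *
        (E * Matrix.diagonal b * E.transpose) =
          E * Matrix.diagonal (fun i => a i * b i) * E.transpose := by
      intro a b
      rw [← Matrix.diagonal_mul_diagonal]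
      calc _ = E * Matrix.diagonal a * (E.transpose * E) * Matrix.diagonal b * E.transpose := by
            simp only [Matrix.mul_assoc]
        _ = _ := by rw [hE]; simp only [Matrix.mul_assoc, Matrix.one_mul]
    refine ⟨E * Matrix.diagonal (fun i => (D i)⁻¹) * E.transpose, ?_, ?_, ?_, ?_⟩
    · rw [hD, hc, hc]; simp
    · rw [hD, hc, hc]
      congr 3
      ext i
      by_cases h : D i = 0
      · simp [h]
      · field_simp
    · simp [Matrix.mul_assoc]
    · rw [hD, hc, hc]; simp [mul_comm]
  refine ⟨R * M.transpose, ?_, ?_, ?_, ?_⟩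
  · have hz : (M * R * G - M).conjTranspose * (M * R * G - M) = 0 := by
      rw [Matrix.conjTranspose_eq_transpose_of_trivial]
      simp only [Matrix.transpose_sub, Matrix.transpose_mul, hGt, h3, Matrix.sub_mul, Matrix.mul_sub]
      have e1 : G * (R * M.transpose) * (M * R * G) = G := by
        calc _ = (G * R * (M.transpose * M)) * R * G := by simp only [Matrix.mul_assoc]
          _ = G := by rw [← hG, h1, h1]
      have e2 : G * (R * M.transpose) * M = G := by
        calc _ = G * R * (M.transpose * M) := by simp only [Matrix.mul_assoc]
          _ = G := by rw [← hG, h1]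
      have e3 : M.transpose * (M * R * G) = G := by
        calc _ = (M.transpose * M) * R * G := by simp only [Matrix.mul_assoc]
          _ = G := by rw [← hG, h1]
      rw [e1, e2, e3, ← hG]; simp
    have := sub_eq_zero.mp (Matrix.conjTranspose_mul_self_eq_zero.mp hz)
    calc M * (R * M.transpose) * M = M * R * G := by rw [hG]; simp only [Matrix.mul_assoc]
      _ = M := this
  · calc _ = (R * (M.transpose * M) * R) * M.transpose := by simp only [Matrix.mul_assoc]
      _ = _ := by rw [← hG, h2]
  · simp [h3, Matrix.mul_assoc]
  · rw [Matrix.mul_assoc, ← hG, Matrix.transpose_mul, h3, hGt, h4]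

theorem IsMoorePenrose.unique {m n : ℕ} {M : Matrix (Fin m) (Fin n) ℝ}
    {X Y : Matrix (Fin n) (Fin m) ℝ} (hX : IsMoorePenrose M X) (hY : IsMoorePenrose M Y) :
    X = Y := by
  have e1 : M * X = M * Y := by
    calc M * X = (M * Y * M) * X := by rw [hY.mul_mul_left]
      _ = (M * Y).transpose * (M * X).transpose := by
          rw [hY.symm_left, hX.symm_left, Matrix.mul_assoc]
      _ = (M * X * M * Y).transpose := by
          rw [← Matrix.transpose_mul]; simp only [Matrix.mul_assoc]
      _ = M * Y := by rw [hX.mul_mul_left, hY.symm_left]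
  have e2 : X * M = Y * M := by
    calc X * M = X * (M * Y * M) := by rw [hY.mul_mul_left]
      _ = (X * M).transpose * (Y * M).transpose := by
          rw [hX.symm_right, hY.symm_right]; simp only [Matrix.mul_assoc]
      _ = (Y * (M * X * M)).transpose := by
          rw [← Matrix.transpose_mul]; simp only [Matrix.mul_assoc]
      _ = Y * M := by rw [hX.mul_mul_left, hY.symm_right]
  calc X = X * M * X := hX.mul_mul_right.symm
    _ = Y * (M * Y) := by rw [e2, Matrix.mul_assoc, e1]
    _ = Y := by rw [← Matrix.mul_assoc, hY.mul_mul_right]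

/-- The Moore–Penrose pseudo-inverse. -/
noncomputable def pinv {m n : ℕ} (M : Matrix (Fin m) (Fin n) ℝ) : Matrix (Fin n) (Fin m) ℝ :=
  (exists_isMoorePenrose M).choose

theorem isMoorePenrose_pinv {m n : ℕ} (M : Matrix (Fin m) (Fin n) ℝ) :
    IsMoorePenrose M (pinv M) :=
  (exists_isMoorePenrose M).choose_spec

/-- The Nyström approximation `(Ω A)ᵀ (Ω A Ωᵀ)† (Ω A)`. -/
noncomputable def nystrom {l n : ℕ} (A : Matrix (Fin n) (Fin n) ℝ) (Ω : Matrix (Fin l) (Fin n) ℝ) :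
    Matrix (Fin n) (Fin n) ℝ :=
  (Ω * A).transpose * pinv (Ω * A * Ω.transpose) * (Ω * A)

/-- The trace (nuclear) norm: the sum of the singular values. -/
noncomputable def traceNorm {m n : ℕ} (M : Matrix (Fin m) (Fin n) ℝ) : ℝ :=
  ∑ i ∈ Finset.range n, (Matrix.toEuclideanLin M).singularValues i

/-- The spectral norm: the operator norm with respect to Euclidean norms. -/
noncomputable def specNorm {n : ℕ} (M : Matrix (Fin n) (Fin n) ℝ) : ℝ :=
  ‖Matrix.toEuclideanCLM (𝕜 := ℝ) M‖

end Sketch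

namespace Sketch

open Matrix

/-! Write `A = G * G` with `G` the symmetric square root, and let `Q` be the orthogonal projection
onto the row space of `Ω * G`. The Nyström approximation is `G Q G`, so the error `G (1 - Q) G` is
positive semidefinite and its trace norm is the squared Frobenius norm of `G (1 - Q)`. By Pythagoras
this is at most that of `G - W Ω G` for every `W` (`trace_sub_nystrom_le`).

Take for `W` the sketched least-squares fit onto the top `d` eigenvectors `E`. The fit reproduces
the columns of `E`. Any other eigenvector `u` leaves a residual of squared norm `1 + |c|²`, where `c
= S⁻¹ (Ω E)ᵀ Ω u` and `S = (Ω E)ᵀ Ω E`. The `1/3` embedding gives `S ≥ 2/3`. The one-dimensional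
embedding, applied to sums and differences of eigenvectors, bounds each entry of `(Ω E)ᵀ Ω u` by `e
= √(ε/d)`. Hence `|c|² ≤ 9/4 * d * e² = ε*` (`trace_sub_nystrom_le_tail`), and a union bound gives
the probability.

For the truncation, the Nyström matrix `N` satisfies `0 ≤ N ≤ A`, so by Weyl the tail of its
spectrum is dominated by that of `A`. Truncating `N` thus costs at most `trace (A - N)` beyond
truncating `A` (`norm_sub_truncation_le`). -/

/-! ### Diagonalization and the trace norm of positive semidefinite matrices -/

theorem posSemidef_conj_diagonal {n : ℕ} (U : Matrix (Fin n) (Fin n) ℝ) {f : Fin n → ℝ}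
    (hf : ∀ i, 0 ≤ f i) : (U * diagonal f * U.transpose).PosSemidef := by
  have := (PosSemidef.diagonal (n := Fin n) (R := ℝ) (d := f) hf).mul_mul_conjTranspose_same U
  rwa [conjTranspose_eq_transpose_of_trivial] at this

/-- A singular value decomposition of a positive semidefinite matrix diagonalizes it. -/
theorem IsTruncatedSVD.exists_diagonalization {n k : ℕ} {M B : Matrix (Fin n) (Fin n) ℝ}
    (hM : M.PosSemidef) (h : IsTruncatedSVD k M B) :
    ∃ U ∈ orthogonalGroup (Fin n) ℝ, ∃ σ : Fin n → ℝ, Antitone σ ∧ (∀ i, 0 ≤ σ i) ∧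
      M = U * diagonal σ * U.transpose ∧
      B = U * diagonal (fun i : Fin n => if (i : ℕ) < k then σ i else 0) * U.transpose := by
  obtain ⟨U, hU, V, hV, σ, hσ, hσ0, rfl, rfl⟩ := h
  have hU' : U.transpose * U = 1 := (mem_orthogonalGroup_iff' (Fin n) ℝ).mp hU
  have hV' : V.transpose * V = 1 := (mem_orthogonalGroup_iff' (Fin n) ℝ).mp hV
  obtain ⟨M, hMdef⟩ : ∃ M, M = U * diagonal σ * V.transpose := ⟨_, rfl⟩
  rw [← hMdef] at hM
  have hMt : M.transpose = M := by
    have := hM.isHermitian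
    rwa [IsHermitian, conjTranspose_eq_transpose_of_trivial] at this
  have e1 : M * V = U * diagonal σ := by
    rw [hMdef, Matrix.mul_assoc, hV', Matrix.mul_one]
  have e2 : M * U = V * diagonal σ := by
    rw [← hMt, hMdef]
    simp only [transpose_mul, diagonal_transpose, transpose_transpose]
    rw [Matrix.mul_assoc, Matrix.mul_assoc, hU', Matrix.mul_one]
  -- `M` swaps the `i`-th columns of `U` and `V` up to the factor `σ i`, so their difference
  -- satisfies `M x = -σ i • x`; semidefiniteness leaves only `x = 0` when `σ i > 0`.
  have key : ∀ i, σ i ≠ 0 → ∀ a, V a i = U a i := by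
    intro i hi
    set x : Fin n → ℝ := fun a => V a i - U a i with hx
    have h3 : M *ᵥ x = -σ i • x := by
      have h4 : M * (V - U) = (V - U) * diagonal (fun i => -σ i) := by
        rw [Matrix.mul_sub, e1, e2, ← diagonal_neg, Matrix.mul_neg, Matrix.sub_mul]; abel
      ext a
      have := congrFun (congrFun h4 a) i
      rw [mul_diagonal, mul_apply] at this
      simp only [mulVec, dotProduct, hx, Pi.smul_apply, smul_eq_mul]
      simp only [Matrix.sub_apply] at this
      rw [this]; ring
    have h5 := hM.dotProduct_mulVec_nonneg x
    rw [h3, dotProduct_smul, star_trivial, smul_eq_mul] at h5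
    have h6 : 0 < σ i := lt_of_le_of_ne (hσ0 i) (Ne.symm hi)
    have h7 : x ⬝ᵥ x = 0 := by
      have h8 : 0 ≤ x ⬝ᵥ x := Finset.sum_nonneg fun a _ => mul_self_nonneg _
      nlinarith
    intro a
    have := congrFun (dotProduct_self_eq_zero.mp h7) a
    simp only [hx, Pi.zero_apply] at this
    linarith
  -- Columns with `σ i = 0` may differ between `U` and `V`, but they carry weight zero.
  have h8 : ∀ f : Fin n → ℝ, (∀ i, σ i = 0 → f i = 0) →
      U * diagonal f * V.transpose = U * diagonal f * U.transpose := by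
    intro f hf
    have : V * diagonal f = U * diagonal f := by
      ext a i
      rw [mul_diagonal, mul_diagonal]
      by_cases hi : σ i = 0
      · simp [hf i hi]
      · rw [key i hi a]
    have := congrArg transpose this
    simp only [transpose_mul, diagonal_transpose] at this
    rw [Matrix.mul_assoc, Matrix.mul_assoc, this]
  refine ⟨U, hU, σ, hσ, hσ0, h8 σ fun _ h => h, h8 _ fun i hi => ?_⟩
  simp [hi]

theorem trace_conj_diagonal {n : ℕ} {U : Matrix (Fin n) (Fin n) ℝ}
    (hU : U ∈ orthogonalGroup (Fin n) ℝ) (f : Fin n → ℝ) :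
    (U * diagonal f * U.transpose).trace = ∑ i, f i := by
  rw [trace_mul_cycle, show U.transpose * U = 1 from (mem_orthogonalGroup_iff' (Fin n) ℝ).mp hU,
    Matrix.one_mul, trace_diagonal]

/-- The squared singular values are the roots of the characteristic polynomial of `MᵀM`, which is
that of `diagonal (f ^ 2)`. Comparing roots as multisets requires no ordering of `f`. -/
theorem traceNorm_conj_diagonal {n : ℕ} {U : Matrix (Fin n) (Fin n) ℝ}
    (hU : U ∈ orthogonalGroup (Fin n) ℝ) {f : Fin n → ℝ} (hf : ∀ i, 0 ≤ f i) :
    traceNorm (U * diagonal f * U.transpose) = ∑ i, f i := by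
  have hU' : U.transpose * U = 1 := (mem_orthogonalGroup_iff' (Fin n) ℝ).mp hU
  have hU'' : U * U.transpose = 1 := (mem_orthogonalGroup_iff (Fin n) ℝ).mp hU
  set M := U * diagonal f * U.transpose with hM
  set T := toEuclideanLin M with hT
  have hn : Module.finrank ℝ (EuclideanSpace ℝ (Fin n)) = n := by simp
  have hS := T.isSymmetric_adjoint_comp_self
  have hTT : LinearMap.adjoint T ∘ₗ T = toEuclideanLin (M.conjTranspose * M) := by
    rw [hT, ← toEuclideanLin_conjTranspose_eq_adjoint]
    ext x : 1
    simp [toLpLin_apply, mulVec_mulVec]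
  have hMM : M.conjTranspose * M = U * diagonal (fun i => f i ^ 2) * U.transpose := by
    rw [conjTranspose_eq_transpose_of_trivial, hM]
    simp only [transpose_mul, diagonal_transpose, transpose_transpose]
    calc _ = U * diagonal f * (U.transpose * U) * diagonal f * U.transpose := by
          simp only [Matrix.mul_assoc]
      _ = U * (diagonal f * diagonal f) * U.transpose := by
          rw [hU']; simp only [Matrix.mul_assoc, Matrix.one_mul]
      _ = _ := by rw [diagonal_mul_diagonal]; simp only [sq]
  have hchar : (LinearMap.adjoint T ∘ₗ T).charpoly =
      (diagonal (fun i => f i ^ 2) : Matrix (Fin n) (Fin n) ℝ).charpoly := by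
    rw [hTT, hMM, toEuclideanLin_eq_toLin_orthonormal, Matrix.charpoly_toLin]
    rw [charpoly_mul_comm, ← Matrix.mul_assoc, hU', Matrix.one_mul]
  have hroots := hS.roots_charpoly_eq_eigenvalues hn
  rw [hchar, charpoly_diagonal, Polynomial.roots_prod _ _ 
    (Finset.prod_ne_zero_iff.mpr fun i _ => Polynomial.X_sub_C_ne_zero _)] at hroots
  simp only [Polynomial.roots_X_sub_C, Multiset.bind_singleton] at hroots
  have h1 := congrArg (fun s => (s.map Real.sqrt).sum) hroots
  simp only [Multiset.map_map] at h1
  have h2 : ∑ i, √(f i ^ 2) = ∑ i, √(hS.eigenvalues hn i) := h1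
  simp only [Real.sqrt_sq (hf _)] at h2
  rw [h2, traceNorm, Finset.sum_range]
  exact Finset.sum_congr rfl fun i _ => T.singularValues_fin hn i

theorem traceNorm_of_posSemidef {n : ℕ} {M : Matrix (Fin n) (Fin n) ℝ} (hM : M.PosSemidef) :
    traceNorm M = M.trace := by
  obtain ⟨B, hB⟩ := exists_isTruncatedSVD 0 M
  obtain ⟨U, hU, σ, -, h0, rfl, -⟩ := hB.exists_diagonalization hM
  rw [traceNorm_conj_diagonal hU h0, trace_conj_diagonal hU]

/-! ### Monotonicity of eigenvalues and the cost of truncation -/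

theorem dotProduct_conj_diagonal_mulVec {n : ℕ} (U : Matrix (Fin n) (Fin n) ℝ) (f x : Fin n → ℝ) :
    x ⬝ᵥ ((U * diagonal f * U.transpose) *ᵥ x) = ∑ i, f i * (U.transpose *ᵥ x) i ^ 2 := by
  rw [← mulVec_mulVec, ← mulVec_mulVec, dotProduct_mulVec, ← mulVec_transpose, dotProduct]
  refine Finset.sum_congr rfl fun i _ => ?_
  rw [mulVec_diagonal]; ring

theorem sum_sq_transpose_mulVec {n : ℕ} {U : Matrix (Fin n) (Fin n) ℝ}
    (hU : U ∈ orthogonalGroup (Fin n) ℝ) (x : Fin n → ℝ) :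
    ∑ i, (U.transpose *ᵥ x) i ^ 2 = x ⬝ᵥ x := by
  have h := dotProduct_conj_diagonal_mulVec U (fun _ => 1) x
  rw [diagonal_one, Matrix.mul_one, show U * U.transpose = 1 from
    (mem_orthogonalGroup_iff (Fin n) ℝ).mp hU, one_mulVec] at h
  simpa using h.symm

/-- Weyl's monotonicity of eigenvalues. -/
theorem eigenvalue_le_of_posSemidef_sub {n : ℕ} {U W : Matrix (Fin n) (Fin n) ℝ}
    (hU : U ∈ orthogonalGroup (Fin n) ℝ) (hW : W ∈ orthogonalGroup (Fin n) ℝ)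
    {σ τ : Fin n → ℝ} (hσ : Antitone σ) (hτ : Antitone τ)
    (h : (W * diagonal τ * W.transpose - U * diagonal σ * U.transpose).PosSemidef) (j : Fin n) :
    σ j ≤ τ j := by
  -- A nonzero `x` orthogonal to the columns of `W` before `j` and to those of `U` after `j` exists,
  -- since row `j` of this system is zero. On it the two quadratic forms are at most `τ j |x|²` and
  -- at least `σ j |x|²`.
  obtain ⟨x, hx0, hx⟩ : ∃ x ≠ 0, (Matrix.of fun i => if i < j then W.transpose i
      else if j < i then U.transpose i else 0) *ᵥ x = 0 := by
    rw [exists_mulVec_eq_zero_iff]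
    exact det_eq_zero_of_row_eq_zero j fun a => by simp
  have hW0 : ∀ i, i < j → (W.transpose *ᵥ x) i = 0 := fun i hi => by
    simpa [mulVec, hi] using congrFun hx i
  have hU0 : ∀ i, j < i → (U.transpose *ᵥ x) i = 0 := fun i hi => by
    simpa [mulVec, hi, hi.not_gt] using congrFun hx i
  have h1 := h.dotProduct_mulVec_nonneg x
  rw [star_trivial, sub_mulVec, dotProduct_sub, dotProduct_conj_diagonal_mulVec,
    dotProduct_conj_diagonal_mulVec] at h1
  have h2 : σ j * (x ⬝ᵥ x) ≤ ∑ i, σ i * (U.transpose *ᵥ x) i ^ 2 := by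
    rw [← sum_sq_transpose_mulVec hU, Finset.mul_sum]
    refine Finset.sum_le_sum fun i _ => ?_
    rcases lt_or_ge j i with hi | hi
    · simp [hU0 i hi]
    · exact mul_le_mul_of_nonneg_right (hσ hi) (sq_nonneg _)
  have h3 : ∑ i, τ i * (W.transpose *ᵥ x) i ^ 2 ≤ τ j * (x ⬝ᵥ x) := by
    rw [← sum_sq_transpose_mulVec hW, Finset.mul_sum]
    refine Finset.sum_le_sum fun i _ => ?_
    rcases lt_or_ge i j with hi | hi
    · simp [hW0 i hi]
    · exact mul_le_mul_of_nonneg_right (hτ hi) (sq_nonneg _)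
  have h4 : 0 < x ⬝ᵥ x := lt_of_le_of_ne (Finset.sum_nonneg fun a _ => mul_self_nonneg _)
    fun h => hx0 (dotProduct_self_eq_zero.mp h.symm)
  exact le_of_mul_le_mul_right (by linarith) h4

open scoped Matrix.Norms.L2Operator in
theorem specNorm_conj_diagonal {n : ℕ} {U : Matrix (Fin n) (Fin n) ℝ}
    (hU : U ∈ orthogonalGroup (Fin n) ℝ) (f : Fin n → ℝ) :
    specNorm (U * diagonal f * U.transpose) = ‖f‖ := by
  rw [specNorm, ← l2_opNorm_diagonal (𝕜 := ℝ) f]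
  have h1 := CStarRing.norm_coe_unitary_mul (⟨U, hU⟩ : unitary _) (diagonal f)
  have h2 := CStarRing.norm_mul_coe_unitary (U * diagonal f) (star (⟨U, hU⟩ : unitary _))
  exact h2.trans h1

theorem specNorm_add_le {n : ℕ} (M N : Matrix (Fin n) (Fin n) ℝ) :
    specNorm (M + N) ≤ specNorm M + specNorm N := by
  rw [specNorm, map_add]; exact norm_add_le _ _

theorem specNorm_le_trace_of_posSemidef {n : ℕ} {M : Matrix (Fin n) (Fin n) ℝ}
    (hM : M.PosSemidef) : specNorm M ≤ M.trace := by
  obtain ⟨B, hB⟩ := exists_isTruncatedSVD 0 M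
  obtain ⟨U, hU, σ, -, h0, rfl, -⟩ := hB.exists_diagonalization hM
  rw [specNorm_conj_diagonal hU, trace_conj_diagonal hU,
    pi_norm_le_iff_of_nonneg (Finset.sum_nonneg fun i _ => h0 i)]
  intro i
  rw [Real.norm_of_nonneg (h0 i)]
  exact Finset.single_le_sum (fun i _ => h0 i) (Finset.mem_univ i)

theorem conj_diagonal_sub_truncation {n : ℕ} (U : Matrix (Fin n) (Fin n) ℝ) (σ : Fin n → ℝ)
    (k : ℕ) : U * diagonal σ * U.transpose -
      U * diagonal (fun i : Fin n => if (i : ℕ) < k then σ i else 0) * U.transpose =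
      U * diagonal (fun i : Fin n => if (i : ℕ) < k then 0 else σ i) * U.transpose := by
  rw [← Matrix.sub_mul, ← Matrix.mul_sub, diagonal_sub]
  congr 3
  ext i
  split_ifs <;> simp

/-- Truncating a positive semidefinite `N ≤ A` costs at most `trace (A - N)` more than
truncating `A`. -/
theorem norm_sub_truncation_le {n k : ℕ} {A N Ak Nk : Matrix (Fin n) (Fin n) ℝ}
    (hA : A.PosSemidef) (hN : N.PosSemidef) (hAN : (A - N).PosSemidef)
    (hAk : IsTruncatedSVD k A Ak) (hNk : IsTruncatedSVD k N Nk) :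
    specNorm (A - Nk) ≤ specNorm (A - Ak) + (A - N).trace ∧
      traceNorm (A - Nk) ≤ traceNorm (A - Ak) + (A - N).trace := by
  obtain ⟨W, hW, τ, hτ, hτ0, hA', hAk'⟩ := hAk.exists_diagonalization hA
  obtain ⟨U, hU, σ, hσ, hσ0, hN', hNk'⟩ := hNk.exists_diagonalization hN
  have hle := eigenvalue_le_of_posSemidef_sub hU hW hσ hτ (by rwa [← hA', ← hN'])
  have eA := conj_diagonal_sub_truncation W τ k
  have eN := conj_diagonal_sub_truncation U σ k
  rw [← hA', ← hAk'] at eA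
  rw [← hN', ← hNk'] at eN
  have hσk : ∀ i : Fin n, 0 ≤ if (i : ℕ) < k then 0 else σ i := fun i => by
    split_ifs <;> simp [hσ0 i]
  have hτk : ∀ i : Fin n, 0 ≤ if (i : ℕ) < k then 0 else τ i := fun i => by
    split_ifs <;> simp [hτ0 i]
  have hk : ∀ i : Fin n, (if (i : ℕ) < k then 0 else σ i) ≤ if (i : ℕ) < k then 0 else τ i :=
    fun i => by split_ifs <;> simp [hle i]
  -- In either norm the first summand costs at most its trace; the second has as eigenvalues the
  -- tail of `σ`, dominated entrywise by that of `τ`.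
  have hsplit : A - Nk = (A - N) + (N - Nk) := by abel
  have hNNk : (N - Nk).PosSemidef := eN ▸ posSemidef_conj_diagonal U hσk
  constructor
  · rw [hsplit, add_comm (specNorm _)]
    refine (specNorm_add_le _ _).trans (add_le_add (specNorm_le_trace_of_posSemidef hAN) ?_)
    rw [eA, eN, specNorm_conj_diagonal hU, specNorm_conj_diagonal hW,
      pi_norm_le_iff_of_nonneg (norm_nonneg _)]
    intro i
    rw [Real.norm_of_nonneg (hσk i)]
    exact (hk i).trans ((le_abs_self _).trans (norm_le_pi_norm
      (fun i : Fin n => if (i : ℕ) < k then 0 else τ i) i))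
  · rw [traceNorm_of_posSemidef (hsplit ▸ hAN.add hNNk), hsplit, trace_add, add_comm,
      eA, eN, trace_conj_diagonal hU, traceNorm_conj_diagonal hW hτk]
    gcongr with i
    exact hk i

theorem traceNorm_sub_truncation {n d : ℕ} {U : Matrix (Fin n) (Fin n) ℝ}
    (hU : U ∈ orthogonalGroup (Fin n) ℝ) {σ : Fin n → ℝ} (hσ : ∀ i, 0 ≤ σ i) :
    traceNorm (U * diagonal σ * U.transpose -
      U * diagonal (fun i : Fin n => if (i : ℕ) < d then σ i else 0) * U.transpose) =
      ∑ i : Fin n, if (i : ℕ) < d then 0 else σ i := by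
  rw [conj_diagonal_sub_truncation, traceNorm_conj_diagonal hU]
  intro i
  split_ifs <;> simp [hσ i]

/-! ### The Nyström approximation as a projection -/

theorem IsMoorePenrose.transpose {m n : ℕ} {M : Matrix (Fin m) (Fin n) ℝ}
    {X : Matrix (Fin n) (Fin m) ℝ} (h : IsMoorePenrose M X) :
    IsMoorePenrose M.transpose X.transpose where
  mul_mul_left := by
    rw [← transpose_mul, ← transpose_mul, ← Matrix.mul_assoc, h.mul_mul_left]
  mul_mul_right := by
    rw [← transpose_mul, ← transpose_mul, ← Matrix.mul_assoc, h.mul_mul_right]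
  symm_left := by rw [← transpose_mul, h.symm_right, h.symm_right]
  symm_right := by rw [← transpose_mul, h.symm_left, h.symm_left]

theorem transpose_pinv_of_symm {m : ℕ} {M : Matrix (Fin m) (Fin m) ℝ} (hM : M.transpose = M) :
    (pinv M).transpose = pinv M := by
  have h := (isMoorePenrose_pinv M).transpose
  rw [hM] at h
  exact h.unique (isMoorePenrose_pinv M)

/-- The orthogonal projection onto the row space of `B`. -/
noncomputable def rowProj {l n : ℕ} (B : Matrix (Fin l) (Fin n) ℝ) : Matrix (Fin n) (Fin n) ℝ :=
  B.transpose * pinv (B * B.transpose) * B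

theorem rowProj_transpose {l n : ℕ} (B : Matrix (Fin l) (Fin n) ℝ) :
    (rowProj B).transpose = rowProj B := by
  have h := transpose_pinv_of_symm (M := B * B.transpose) (by simp)
  simp only [rowProj, transpose_mul, transpose_transpose, h, Matrix.mul_assoc]

theorem rowProj_mul_self {l n : ℕ} (B : Matrix (Fin l) (Fin n) ℝ) :
    rowProj B * rowProj B = rowProj B := by
  have h := (isMoorePenrose_pinv (B * B.transpose)).mul_mul_right
  simp only [rowProj]
  conv_rhs => rw [← h]
  simp only [Matrix.mul_assoc]

/-- With `S = B Bᵀ`, the difference of the two sides is `(S S† - 1) B`. Multiplied by its own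
transpose it gives `(S S† - 1) S (S S† - 1)ᵀ`, which vanishes because `S S† S = S`. -/
theorem mul_rowProj {l n : ℕ} (B : Matrix (Fin l) (Fin n) ℝ) : B * rowProj B = B := by
  obtain ⟨S, hS⟩ : ∃ S, S = B * B.transpose := ⟨_, rfl⟩
  have h1 := (isMoorePenrose_pinv S).mul_mul_left
  have hSt : S.transpose = S := by rw [hS]; simp
  have h2 := transpose_pinv_of_symm hSt
  have hz : (B * rowProj B - B) * (B * rowProj B - B).conjTranspose = 0 := by
    have e : B * rowProj B - B = (S * pinv S - 1) * B := by
      rw [rowProj, ← hS, Matrix.sub_mul, Matrix.one_mul, hS]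
      simp only [Matrix.mul_assoc]
    rw [conjTranspose_eq_transpose_of_trivial, e, transpose_mul]
    calc _ = (S * pinv S - 1) * (B * B.transpose) * (S * pinv S - 1).transpose := by
          simp only [Matrix.mul_assoc]
      _ = 0 := by rw [← hS, Matrix.sub_mul, h1, Matrix.one_mul, sub_self, Matrix.zero_mul]
  exact sub_eq_zero.mp (self_mul_conjTranspose_eq_zero.mp hz)

theorem posSemidef_mul_transpose {m n : ℕ} (M : Matrix (Fin m) (Fin n) ℝ) :
    (M * M.transpose).PosSemidef := by
  rw [← conjTranspose_eq_transpose_of_trivial]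
  exact posSemidef_self_mul_conjTranspose M

/-- Since `Ω G G Ωᵀ = (Ω G)(Ω G)ᵀ`, the pseudo-inverse is the one inside `rowProj (Ω * G)`. The
factored form, available because the projection is idempotent, exhibits positive semidefiniteness;
`sub_nystrom_eq` does the same for the error. -/
theorem nystrom_eq_mul_rowProj {l n : ℕ} {G : Matrix (Fin n) (Fin n) ℝ} (hG : G.transpose = G)
    (Ω : Matrix (Fin l) (Fin n) ℝ) :
    nystrom (G * G) Ω = G * rowProj (Ω * G) * (G * rowProj (Ω * G)).transpose := by
  have e : G * rowProj (Ω * G) * (G * rowProj (Ω * G)).transpose = G * rowProj (Ω * G) * G := by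
    rw [transpose_mul, rowProj_transpose, hG]
    calc _ = G * (rowProj (Ω * G) * rowProj (Ω * G)) * G := by simp only [Matrix.mul_assoc]
      _ = _ := by rw [rowProj_mul_self]
  rw [e]
  simp only [nystrom, rowProj, transpose_mul, hG, Matrix.mul_assoc]

theorem sub_nystrom_eq {l n : ℕ} {G : Matrix (Fin n) (Fin n) ℝ} (hG : G.transpose = G)
    (Ω : Matrix (Fin l) (Fin n) ℝ) :
    G * G - nystrom (G * G) Ω =
      G * (1 - rowProj (Ω * G)) * (G * (1 - rowProj (Ω * G))).transpose := by
  rw [nystrom_eq_mul_rowProj hG]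
  obtain ⟨Q, hQ⟩ : ∃ Q, Q = rowProj (Ω * G) := ⟨_, rfl⟩
  have h1 : Q.transpose = Q := by rw [hQ, rowProj_transpose]
  have h2 : Q * Q = Q := by rw [hQ, rowProj_mul_self]
  rw [← hQ]
  have e : (1 - Q) * (1 - Q) = 1 - Q := by
    rw [Matrix.mul_sub, Matrix.mul_one, Matrix.sub_mul, h2, Matrix.one_mul, sub_self, sub_zero]
  simp only [transpose_mul, transpose_sub, transpose_one, h1, hG]
  calc _ = G * G - G * (Q * Q) * G := by simp only [Matrix.mul_assoc]
    _ = G * ((1 - Q) * (1 - Q)) * G := by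
        rw [e, h2, Matrix.mul_sub, Matrix.mul_one, Matrix.sub_mul]
    _ = _ := by simp only [Matrix.mul_assoc]

/-- The error of the Nyström approximation is at most that of any approximation of the square
root `G` of the matrix whose rows are combinations of the rows of `Ω * G`. -/
theorem trace_sub_nystrom_le {l n : ℕ} {G : Matrix (Fin n) (Fin n) ℝ} (hG : G.transpose = G)
    (Ω : Matrix (Fin l) (Fin n) ℝ) (W : Matrix (Fin n) (Fin l) ℝ) :
    (G * G - nystrom (G * G) Ω).trace ≤
      ((G - W * (Ω * G)) * (G - W * (Ω * G)).transpose).trace := by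
  rw [sub_nystrom_eq hG]
  obtain ⟨Q, hQ⟩ : ∃ Q, Q = rowProj (Ω * G) := ⟨_, rfl⟩
  have h1 : Q.transpose = Q := by rw [hQ, rowProj_transpose]
  have h2 : Q * Q = Q := by rw [hQ, rowProj_mul_self]
  have h3 : Ω * G * Q = Ω * G := by rw [hQ, mul_rowProj]
  rw [← hQ]
  obtain ⟨F, hF⟩ : ∃ F, F = G - W * (Ω * G) := ⟨_, rfl⟩
  -- `1 - Q` annihilates `W Ω G`, so `G` may be replaced by `F`; dropping the part `F Q` is then
  -- Pythagoras.
  have e : G * (1 - Q) = F - F * Q := by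
    rw [hF, Matrix.sub_mul, Matrix.mul_assoc W, h3, Matrix.mul_sub, Matrix.mul_one]; abel
  have e2 : (F - F * Q) * (F - F * Q).transpose =
      F * F.transpose - F * Q * (F * Q).transpose := by
    simp only [transpose_sub, transpose_mul, h1, Matrix.sub_mul, Matrix.mul_sub]
    have : F * Q * (Q * F.transpose) = F * Q * F.transpose := by
      calc _ = F * (Q * Q) * F.transpose := by simp only [Matrix.mul_assoc]
        _ = _ := by rw [h2]
    rw [this]
    simp only [Matrix.mul_assoc]
    abel
  rw [← hF, e, e2, trace_sub]
  linarith [(posSemidef_mul_transpose (F * Q)).trace_nonneg]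

/-! ### The deterministic error bound -/

theorem dotProduct_inv_mulVec_le {d : ℕ} {S : Matrix (Fin d) (Fin d) ℝ}
    (hS : ∀ c : Fin d → ℝ, 2 / 3 * (c ⬝ᵥ c) ≤ c ⬝ᵥ (S *ᵥ c)) :
    IsUnit S.det ∧ ∀ v, (S⁻¹ *ᵥ v) ⬝ᵥ (S⁻¹ *ᵥ v) ≤ 9 / 4 * (v ⬝ᵥ v) := by
  have hu : IsUnit S.det := by
    rw [isUnit_iff_ne_zero]
    intro h0
    obtain ⟨c, hc0, hc⟩ := exists_mulVec_eq_zero_iff.mpr h0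
    have h1 := hS c
    rw [hc, dotProduct_zero] at h1
    have h2 : 0 ≤ c ⬝ᵥ c := Finset.sum_nonneg fun a _ => mul_self_nonneg _
    exact hc0 (dotProduct_self_eq_zero.mp (by linarith))
  refine ⟨hu, fun v => ?_⟩
  have h1 := hS (S⁻¹ *ᵥ v)
  rw [mulVec_mulVec, mul_nonsing_inv _ hu, one_mulVec] at h1
  set c := S⁻¹ *ᵥ v
  -- Expanding gives `12 c·v ≤ 4 c·c + 9 v·v`, while coercivity gives `8 c·c ≤ 12 c·v`.
  have h2 : 0 ≤ ((2 : ℝ) • c - (3 : ℝ) • v) ⬝ᵥ ((2 : ℝ) • c - (3 : ℝ) • v) :=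
    Finset.sum_nonneg fun a _ => mul_self_nonneg _
  simp only [sub_dotProduct, dotProduct_sub, smul_dotProduct, dotProduct_smul, smul_eq_mul,
    dotProduct_comm v c] at h2
  linarith

theorem sqrt_conj_diagonal {n : ℕ} {U : Matrix (Fin n) (Fin n) ℝ}
    (hU : U ∈ orthogonalGroup (Fin n) ℝ) {τ : Fin n → ℝ} (hτ : ∀ i, 0 ≤ τ i) :
    (U * diagonal (fun i => √(τ i)) * U.transpose).transpose =
      U * diagonal (fun i => √(τ i)) * U.transpose ∧
    U * diagonal τ * U.transpose = U * diagonal (fun i => √(τ i)) * U.transpose *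
      (U * diagonal (fun i => √(τ i)) * U.transpose) := by
  have hU' : U.transpose * U = 1 := (mem_orthogonalGroup_iff' (Fin n) ℝ).mp hU
  refine ⟨by simp only [transpose_mul, transpose_transpose, diagonal_transpose, Matrix.mul_assoc],
    ?_⟩
  obtain ⟨D, hD⟩ : ∃ D : Matrix (Fin n) (Fin n) ℝ, D = diagonal fun i => √(τ i) := ⟨_, rfl⟩
  have : diagonal τ = D * D := by
    rw [hD, diagonal_mul_diagonal]; simp only [Real.mul_self_sqrt (hτ _)]
  rw [this, ← hD]
  calc _ = U * D * 1 * D * U.transpose := by simp only [Matrix.mul_assoc, Matrix.one_mul]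
    _ = _ := by rw [← hU']; simp only [Matrix.mul_assoc]

/-- Deterministic error bound for the Nyström approximation of `U * diagonal τ * Uᵀ`, when `Ω`
nearly preserves the norms on the span of the first `d` columns of `U` and keeps the other columns
nearly orthogonal to them. -/
theorem trace_sub_nystrom_le_tail {l n d : ℕ} (hdn : d ≤ n) {U : Matrix (Fin n) (Fin n) ℝ}
    (hU : U ∈ orthogonalGroup (Fin n) ℝ) {τ : Fin n → ℝ} (hτ : ∀ i, 0 ≤ τ i)
    (Ω : Matrix (Fin l) (Fin n) ℝ) {e : ℝ}
    (h1 : ∀ c : Fin d → ℝ, 2 / 3 * (c ⬝ᵥ c) ≤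
      ((Ω * U.submatrix id (Fin.castLE hdn)) *ᵥ c) ⬝ᵥ
        ((Ω * U.submatrix id (Fin.castLE hdn)) *ᵥ c))
    (h2 : ∀ (i : Fin d) (j : Fin n), d ≤ (j : ℕ) →
      |((Ω * U).transpose * (Ω * U)) (Fin.castLE hdn i) j| ≤ e) :
    (U * diagonal τ * U.transpose - nystrom (U * diagonal τ * U.transpose) Ω).trace ≤
      (1 + 9 / 4 * (d * e ^ 2)) * ∑ j : Fin n, if (j : ℕ) < d then 0 else τ j := by
  have hU' : U.transpose * U = 1 := (mem_orthogonalGroup_iff' (Fin n) ℝ).mp hU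
  obtain ⟨J, hJ⟩ : ∃ J : Matrix (Fin n) (Fin d) ℝ,
    J = (1 : Matrix (Fin n) (Fin n) ℝ).submatrix id (Fin.castLE hdn) := ⟨_, rfl⟩
  have hmulJ : ∀ {m : ℕ} (M : Matrix (Fin m) (Fin n) ℝ),
      M * J = M.submatrix id (Fin.castLE hdn) := by
    intro m M
    ext a i
    simp [hJ, mul_apply, one_apply]
  have hJJ : J.transpose * J = 1 := by
    rw [hmulJ]
    ext i i'
    simp [hJ, one_apply]
  obtain ⟨E, hE⟩ : ∃ E, E = U * J := ⟨_, rfl⟩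
  rw [← hmulJ, ← hE] at h1
  have hEE : E.transpose * E = 1 := by
    rw [hE, transpose_mul]
    calc _ = J.transpose * (U.transpose * U) * J := by simp only [Matrix.mul_assoc]
      _ = 1 := by rw [hU', Matrix.mul_one, hJJ]
  obtain ⟨S, hS⟩ : ∃ S, S = (Ω * E).transpose * (Ω * E) := ⟨_, rfl⟩
  obtain ⟨hSu, hSinv⟩ := dotProduct_inv_mulVec_le (S := S) (fun c => by
    refine (h1 c).trans_eq ?_
    rw [hS, ← mulVec_mulVec _ (Ω * E).transpose, dotProduct_mulVec c, vecMul_transpose])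
  -- Column `j` of `C` holds the coefficients of the least-squares fit of `Ω u_j` by the columns of
  -- `Ω E`. `R` below is the Gram matrix of the residuals `u_j - E c_j`.
  obtain ⟨C, hC⟩ : ∃ C, C = S⁻¹ * ((Ω * E).transpose * (Ω * U)) := ⟨_, rfl⟩
  have hCJ : C * J = 1 := by
    rw [hC, Matrix.mul_assoc, Matrix.mul_assoc, Matrix.mul_assoc Ω, ← hE, ← hS,
      nonsing_inv_mul _ hSu]
  obtain ⟨R, hR⟩ : ∃ R, R = (U - E * C).transpose * (U - E * C) := ⟨_, rfl⟩
  have hR' : R = 1 - J * C - (J * C).transpose + C.transpose * C := by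
    have e1 : U.transpose * (E * C) = J * C := by
      rw [hE]
      calc _ = (U.transpose * U) * (J * C) := by simp only [Matrix.mul_assoc]
        _ = _ := by rw [hU', Matrix.one_mul]
    have e2 : (E * C).transpose * (E * C) = C.transpose * C := by
      rw [transpose_mul]
      calc _ = C.transpose * (E.transpose * E) * C := by simp only [Matrix.mul_assoc]
        _ = _ := by rw [hEE, Matrix.mul_one]
    have e3 : (E * C).transpose * U = (J * C).transpose := by
      rw [← e1]; simp only [transpose_mul, transpose_transpose]
    rw [hR, transpose_sub, Matrix.sub_mul, Matrix.mul_sub, Matrix.mul_sub, hU', e1, e2, e3]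
    abel
  -- For `j < d`, `u_j` is a column of `E`, which the fit reproduces (`C J = 1`).
  have hRlow : ∀ j : Fin n, (j : ℕ) < d → R j j = 0 := by
    intro j hj
    obtain ⟨i, rfl⟩ : ∃ i : Fin d, Fin.castLE hdn i = j := ⟨⟨j, hj⟩, rfl⟩
    have e1 : J.transpose * R * J = 0 := by
      have e2 : J.transpose * C.transpose = 1 := by rw [← transpose_mul, hCJ, transpose_one]
      rw [hR']
      simp only [Matrix.mul_add, Matrix.mul_sub, Matrix.add_mul, Matrix.sub_mul, transpose_mul,
        Matrix.mul_one, hJJ]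
      have e3 : J.transpose * (J * C) * J = 1 := by
        rw [← Matrix.mul_assoc, hJJ, Matrix.one_mul, hCJ]
      have e4 : J.transpose * (C.transpose * J.transpose) * J = 1 := by
        rw [← Matrix.mul_assoc, e2, Matrix.one_mul, hJJ]
      have e5 : J.transpose * (C.transpose * C) * J = 1 := by
        rw [← Matrix.mul_assoc, e2, Matrix.one_mul, hCJ]
      rw [e3, e4, e5]; simp
    have e2 := congrFun (congrFun e1 i) i
    rw [hmulJ, submatrix_apply] at e2
    simpa [hJ, mul_apply, one_apply] using e2
  -- For `j ≥ d`, `u_j` is a unit vector orthogonal to the columns of `E`, so the residual has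
  -- squared norm `1 + |c_j|²`.
  have hRhigh : ∀ j : Fin n, d ≤ (j : ℕ) → R j j ≤ 1 + 9 / 4 * (d * e ^ 2) := by
    intro j hj
    have hJ0 : ∀ i, J j i = 0 := fun i => by
      have : j ≠ Fin.castLE hdn i := fun h => by
        have := congrArg Fin.val h
        simp at this; omega
      simp [hJ, one_apply, this]
    have e1 : R j j = 1 + ∑ i, C i j * C i j := by
      simp [hR', mul_apply, hJ0, Matrix.sub_apply, Matrix.add_apply]
    set v : Fin d → ℝ := fun i => ((Ω * E).transpose * (Ω * U)) i j with hv
    have e2 : (fun i => C i j) = S⁻¹ *ᵥ v := by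
      ext i; rw [hC, mul_apply]; rfl
    have e3 : ∑ i, C i j * C i j ≤ 9 / 4 * (v ⬝ᵥ v) := by
      have := hSinv v
      rwa [← e2] at this
    have e4 : v ⬝ᵥ v ≤ d * e ^ 2 := by
      have : ∀ i, v i * v i ≤ e ^ 2 := by
        intro i
        have e5 : v i = ((Ω * U).transpose * (Ω * U)) (Fin.castLE hdn i) j := by
          simp only [hv]
          rw [hE, ← Matrix.mul_assoc Ω, hmulJ]; rfl
        rw [e5, ← abs_mul_abs_self, sq]
        have := h2 i j hj
        exact mul_self_le_mul_self (abs_nonneg _) this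
      calc v ⬝ᵥ v ≤ ∑ _i : Fin d, e ^ 2 := Finset.sum_le_sum fun i _ => this i
        _ = _ := by simp
    rw [e1]; linarith
  obtain ⟨D, hD⟩ : ∃ D : Matrix (Fin n) (Fin n) ℝ, D = diagonal fun i => √(τ i) := ⟨_, rfl⟩
  have hDt : D.transpose = D := by rw [hD, diagonal_transpose]
  obtain ⟨G, hG⟩ : ∃ G, G = U * D * U.transpose := ⟨_, rfl⟩
  have hGt : G.transpose = G := by
    rw [hG, hD]; exact (sqrt_conj_diagonal hU hτ).1
  have hGG : U * diagonal τ * U.transpose = G * G := by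
    rw [hG, hD]; exact (sqrt_conj_diagonal hU hτ).2
  rw [hGG]
  -- This `W` turns `G - W Ω G` into `(U - E C) D Uᵀ`, whose squared Frobenius norm is the sum of
  -- the `R j j` weighted by `τ j`.
  refine (trace_sub_nystrom_le hGt Ω (E * S⁻¹ * (Ω * E).transpose)).trans ?_
  have e1 : G - E * S⁻¹ * (Ω * E).transpose * (Ω * G) = (U - E * C) * D * U.transpose := by
    rw [hC, hG]
    simp only [Matrix.sub_mul, Matrix.mul_assoc]
  have e2 : (((U - E * C) * D * U.transpose) * ((U - E * C) * D * U.transpose).transpose).trace =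
      ∑ j, τ j * R j j := by
    rw [trace_mul_comm]
    simp only [transpose_mul, transpose_transpose, hDt]
    calc _ = (U * (D * R * D) * U.transpose).trace := by
          rw [hR]; simp only [Matrix.mul_assoc]
      _ = (D * R * D).trace := by rw [trace_mul_cycle, hU', Matrix.one_mul]
      _ = _ := by
          rw [trace]
          refine Finset.sum_congr rfl fun j _ => ?_
          rw [diag_apply, hD, mul_diagonal, diagonal_mul]
          nth_rewrite 3 [← Real.mul_self_sqrt (hτ j)]
          ring
  rw [e1, e2, Finset.mul_sum]
  refine Finset.sum_le_sum fun j _ => ?_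
  split_ifs with hj
  · simp [hRlow j hj]
  · rw [mul_comm]
    exact mul_le_mul_of_nonneg_right (hRhigh j (not_lt.mp hj)) (hτ j)

/-! ### Embedding events and the union bound -/

theorem norm_sq_toLp {n : ℕ} (x : Fin n → ℝ) : ‖WithLp.toLp 2 x‖ ^ 2 = x ⬝ᵥ x := by
  rw [EuclideanSpace.real_norm_sq_eq, dotProduct]
  exact Finset.sum_congr rfl fun i _ => sq _

theorem IsOSE.one_sub_le_prob_vector {S : Type*} [MeasurableSpace S] {P : Measure S}
    [IsProbabilityMeasure P] {l n : ℕ} {Ω : S → Matrix (Fin l) (Fin n) ℝ} {ε δ : ℝ}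
    (h : IsOSE P Ω ε δ 1) {x : Fin n → ℝ} (hx : x ≠ 0) :
    1 - δ ≤ P.real {s | |x ⬝ᵥ x - (Ω s *ᵥ x) ⬝ᵥ (Ω s *ᵥ x)| ≤ ε * (x ⬝ᵥ x)} := by
  have hx' : WithLp.toLp 2 x ≠ 0 := fun h0 => hx (by simpa using h0)
  refine (h.prob_le (Submodule.span ℝ {WithLp.toLp 2 x}) (finrank_span_singleton hx')).trans
    (measureReal_mono fun s hs => ?_)
  have := hs _ (Submodule.mem_span_singleton_self _)
  rwa [toLpLin_toLp, norm_sq_toLp, norm_sq_toLp] at this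

theorem measurableSet_vector_embedding {S : Type*} [MeasurableSpace S] {l n : ℕ}
    {Ω : S → Matrix (Fin l) (Fin n) ℝ} (hΩ : ∀ i j, Measurable fun s => Ω s i j)
    (x : Fin n → ℝ) (c : ℝ) :
    MeasurableSet {s | |x ⬝ᵥ x - (Ω s *ᵥ x) ⬝ᵥ (Ω s *ᵥ x)| ≤ c} := by
  refine measurableSet_le (Measurable.abs (measurable_const.sub ?_)) measurable_const
  simp only [mulVec, dotProduct]
  fun_prop

theorem IsOSE.one_sub_le_prob_range {S : Type*} [MeasurableSpace S] {P : Measure S}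
    [IsProbabilityMeasure P] {l n d : ℕ} {Ω : S → Matrix (Fin l) (Fin n) ℝ} {ε δ : ℝ}
    (h : IsOSE P Ω ε δ d) {E : Matrix (Fin n) (Fin d) ℝ} (hE : E.transpose * E = 1) :
    1 - δ ≤ P.real {s | ∀ c : Fin d → ℝ,
      |c ⬝ᵥ c - ((Ω s * E) *ᵥ c) ⬝ᵥ ((Ω s * E) *ᵥ c)| ≤ ε * (c ⬝ᵥ c)} := by
  have hiso : ∀ c : Fin d → ℝ, (E *ᵥ c) ⬝ᵥ (E *ᵥ c) = c ⬝ᵥ c := fun c => by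
    rw [dotProduct_mulVec, ← mulVec_transpose, mulVec_mulVec, hE, one_mulVec]
  have hinj : Function.Injective (toEuclideanLin E) := by
    rw [injective_iff_map_eq_zero]
    intro c hc
    have h1 : E *ᵥ c.ofLp = 0 := congrArg WithLp.ofLp hc
    have h2 := hiso c.ofLp
    rw [h1, zero_dotProduct] at h2
    exact WithLp.ofLp_injective 2 (dotProduct_self_eq_zero.mp h2.symm)
  refine (h.prob_le (LinearMap.range (toEuclideanLin E)) ?_).trans
    (measureReal_mono fun s hs c => ?_)
  · rw [LinearMap.finrank_range_of_inj hinj]; simp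
  · have := hs _ ⟨WithLp.toLp 2 c, rfl⟩
    rwa [toLpLin_toLp, toLpLin_toLp, norm_sq_toLp, norm_sq_toLp, toLin'_apply, toLin'_apply,
      hiso, mulVec_mulVec] at this

/-- A union bound in which only the indexed events are required to be measurable. -/
theorem one_sub_le_prob_inter_iInter {S ι : Type*} [MeasurableSpace S] [Fintype ι]
    {P : Measure S} [IsProbabilityMeasure P] {E : Set S} {F : ι → Set S}
    (hF : ∀ t, MeasurableSet (F t)) {δ η : ℝ} (hE : 1 - δ ≤ P.real E)
    (hη : ∀ t, 1 - η ≤ P.real (F t)) :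
    1 - (δ + Fintype.card ι * η) ≤ P.real (E ∩ ⋂ t, F t) := by
  have h1 : P.real E ≤ P.real (E ∩ ⋂ t, F t) + P.real (⋃ t, (F t)ᶜ) := by
    refine (measureReal_mono ?_).trans (measureReal_union_le _ _)
    intro s hs
    by_cases h : s ∈ ⋂ t, F t
    · exact Or.inl ⟨hs, h⟩
    · exact Or.inr (by simpa using h)
  have h2 : P.real (⋃ t, (F t)ᶜ) ≤ Fintype.card ι * η := by
    refine (measureReal_iUnion_fintype_le _).trans ?_
    calc ∑ t, P.real (F t)ᶜ ≤ ∑ _t : ι, η := Finset.sum_le_sum fun t _ => by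
          rw [probReal_compl_eq_one_sub (hF t)]; linarith [hη t]
      _ = _ := by simp
  linarith

/-- Polarization: a map that nearly preserves the norms of `a + b` and `a - b` nearly preserves
the orthogonality of the unit vectors `a` and `b`. -/
theorem abs_dotProduct_le_of_embedding {l n : ℕ} {Ω : Matrix (Fin l) (Fin n) ℝ}
    {a b : Fin n → ℝ} {e : ℝ} (ha : a ⬝ᵥ a = 1) (hb : b ⬝ᵥ b = 1) (hab : a ⬝ᵥ b = 0)
    (h : ∀ r : Bool, |(a + (if r then 1 else -1 : ℝ) • b) ⬝ᵥ (a + (if r then 1 else -1 : ℝ) • b) -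
      (Ω *ᵥ (a + (if r then 1 else -1 : ℝ) • b)) ⬝ᵥ (Ω *ᵥ (a + (if r then 1 else -1 : ℝ) • b))| ≤
      e * ((a + (if r then 1 else -1 : ℝ) • b) ⬝ᵥ (a + (if r then 1 else -1 : ℝ) • b))) :
    |(Ω *ᵥ a) ⬝ᵥ (Ω *ᵥ b)| ≤ e := by
  -- The squared norms of `Ω (a + b)` and `Ω (a - b)` differ by four times the inner product of `Ω
  -- a` and `Ω b`, and each is within `2 * e` of `2`.
  have h1 := h true
  have h2 := h false
  simp only [if_true, Bool.false_eq_true, if_false, mulVec_add, mulVec_smul, add_dotProduct,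
    dotProduct_add, smul_dotProduct, dotProduct_smul, smul_eq_mul, ha, hb, hab,
    dotProduct_comm b a, dotProduct_comm (Ω *ᵥ b) (Ω *ᵥ a)] at h1 h2
  rw [abs_le] at *
  constructor <;> linarith [h1.1, h1.2, h2.1, h2.2]

end Sketch

/-! ### The main theorem -/

theorem mainTheorem4 {S : Type*} [MeasurableSpace S] (P : Measure S) [IsProbabilityMeasure P]
    {l n d k : ℕ} (hd : 1 ≤ d) (hdn : d ≤ n)
    (A : Matrix (Fin n) (Fin n) ℝ) (hA : A.PosSemidef)
    (Ω : S → Matrix (Fin l) (Fin n) ℝ) (hΩ : ∀ i j, Measurable fun s => Ω s i j)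
    (εstar δ : ℝ) (hε0 : 0 ≤ εstar) (hε1 : εstar ≤ 1 / 2)
    (hOSE : Sketch.IsOSE P Ω (1 / 3) δ d)
    (hOSE1 : Sketch.IsOSE P Ω (Real.sqrt (4 / 9 * εstar / (d : ℝ)))
      (δ / (2 * (n : ℝ) * (d : ℝ) + (n : ℝ) + (d : ℝ))) 1)
    (Ad Ak : Matrix (Fin n) (Fin n) ℝ)
    (hAd : Sketch.IsTruncatedSVD d A Ad) (hAk : Sketch.IsTruncatedSVD k A Ak) :
    1 - 2 * δ ≤ P.real {s |
      Sketch.traceNorm (A - Sketch.nystrom A (Ω s)) ≤ (1 + εstar) * Sketch.traceNorm (A - Ad) ∧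
      ∀ Nk, Sketch.IsTruncatedSVD k (Sketch.nystrom A (Ω s)) Nk →
        Sketch.specNorm (A - Nk) ≤ Sketch.specNorm (A - Ak) + 3 * Sketch.traceNorm (A - Ad) ∧
        Sketch.traceNorm (A - Nk) ≤
          Sketch.traceNorm (A - Ak) + 3 * Sketch.traceNorm (A - Ad)} := by
  open Matrix Sketch in
  have hd0 : (0 : ℝ) < d := by exact_mod_cast hd
  have hδ := hOSE.delta_pos
  obtain ⟨U, hU, τ, -, hτ, hAU, hAdU⟩ := hAd.exists_diagonalization hA
  have hU' : U.transpose * U = 1 := (mem_orthogonalGroup_iff' (Fin n) ℝ).mp hU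
  have hcol : ∀ i j, (fun a => U a i) ⬝ᵥ (fun a => U a j) = if i = j then 1 else 0 := fun i j => by
    have := congrFun (congrFun hU' i) j
    rwa [mul_apply, one_apply] at this
  have hE : (U.submatrix id (Fin.castLE hdn)).transpose * U.submatrix id (Fin.castLE hdn) = 1 := by
    ext i j
    exact (hcol _ _).trans (by simp [one_apply])
  set e := √(4 / 9 * εstar / (d : ℝ)) with he
  set η := δ / (2 * (n : ℝ) * (d : ℝ) + (n : ℝ) + (d : ℝ)) with hη
  have hη0 : 0 < η := hOSE1.delta_pos
  let x : Fin d × Fin n × Bool → Fin n → ℝ := fun t =>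
    (fun a => U a (Fin.castLE hdn t.1)) + (if t.2.2 then 1 else -1 : ℝ) • fun a => U a t.2.1
  -- Only pairs with `i < d ≤ j` are needed. The other indices get the sure event, so that the index
  -- set is a full product of size `2 * n * d`, at most `N`.
  let F : Fin d × Fin n × Bool → Set S := fun t => if d ≤ (t.2.1 : ℕ) then
    {s | |x t ⬝ᵥ x t - (Ω s *ᵥ x t) ⬝ᵥ (Ω s *ᵥ x t)| ≤ e * (x t ⬝ᵥ x t)} else Set.univ
  have hne : ∀ (i : Fin d) (j : Fin n), d ≤ (j : ℕ) → Fin.castLE hdn i ≠ j := fun i j hj h => by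
    have := congrArg Fin.val h
    simp at this; omega
  have hF : ∀ t, MeasurableSet (F t) := fun t => by
    simp only [F]
    split_ifs
    · exact measurableSet_vector_embedding hΩ _ _
    · exact MeasurableSet.univ
  have hFη : ∀ t, 1 - η ≤ P.real (F t) := fun ⟨i, j, r⟩ => by
    simp only [F]
    split_ifs with hj
    · refine hOSE1.one_sub_le_prob_vector fun h0 => ?_
      -- The embedding is applied to the line through `x`, so `x` must be nonzero.
      have h1 : (fun a => U a (Fin.castLE hdn i)) ⬝ᵥ x (i, j, r) = 1 := by
        simp only [x, dotProduct_add, dotProduct_smul, hcol, if_neg (hne i j hj)]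
        simp
      rw [h0, dotProduct_zero] at h1
      exact zero_ne_one h1
    · simp [hη0.le]
  refine le_trans ?_ ((one_sub_le_prob_inter_iInter hF (hOSE.one_sub_le_prob_range hE) hFη).trans
    (measureReal_mono ?_))
  · have : (Fintype.card (Fin d × Fin n × Bool) : ℝ) * η ≤ δ := by
      simp only [Fintype.card_prod, Fintype.card_fin, Fintype.card_bool, Nat.cast_mul,
        Nat.cast_ofNat]
      rw [hη, mul_div_assoc', div_le_iff₀ (by positivity)]
      nlinarith [mul_nonneg hδ.le (Nat.cast_nonneg (α := ℝ) n), mul_nonneg hδ.le hd0.le]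
    linarith
  · rintro s ⟨hs1, hs2⟩
    rw [Set.mem_iInter] at hs2
    obtain ⟨t, ht⟩ : ∃ t, t = traceNorm (A - Ad) := ⟨_, rfl⟩
    have ht' : t = ∑ i : Fin n, if (i : ℕ) < d then 0 else τ i := by
      rw [ht, hAdU, hAU, traceNorm_sub_truncation hU hτ]
    have ht0 : 0 ≤ t := by
      rw [ht']
      exact Finset.sum_nonneg fun i _ => by split_ifs <;> simp [hτ i]
    have hmain : (A - nystrom A (Ω s)).trace ≤ (1 + εstar) * t := by
      have h := trace_sub_nystrom_le_tail hdn hU hτ (Ω s) (e := e) (fun c => by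
        have := (abs_le.mp (hs1 c)).2
        linarith) (fun i j hj => by
        refine abs_dotProduct_le_of_embedding (Ω := Ω s) (a := fun a => U a (Fin.castLE hdn i))
          (b := fun a => U a j) (by simp [hcol]) (by simp [hcol])
          (by simp [hcol, hne i j hj]) fun r => ?_
        have := hs2 (i, j, r)
        simp only [F, if_pos hj] at this
        exact this)
      rw [← hAU, ← ht'] at h
      -- The factor `4/9` in `ε` cancels the `9/4` coming from the bound on `S⁻¹`.
      have h2 : 9 / 4 * (d * e ^ 2) = εstar := by
        rw [he, Real.sq_sqrt (by positivity)]
        field_simp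
      rwa [h2] at h
    obtain ⟨G, hG, hGG⟩ : ∃ G : Matrix (Fin n) (Fin n) ℝ, G.transpose = G ∧ A = G * G := by
      rw [hAU]
      exact ⟨_, sqrt_conj_diagonal hU hτ⟩
    have hAN : (A - nystrom A (Ω s)).PosSemidef := by
      rw [hGG, sub_nystrom_eq hG]
      exact posSemidef_mul_transpose _
    have hN : (nystrom A (Ω s)).PosSemidef := by
      rw [hGG, nystrom_eq_mul_rowProj hG]
      exact posSemidef_mul_transpose _
    have h3 : (1 + εstar) * t ≤ 3 * t := mul_le_mul_of_nonneg_right (by linarith) ht0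
    refine ⟨?_, fun Nk hNk => ?_⟩
    · rw [traceNorm_of_posSemidef hAN, ← ht]
      exact hmain
    · obtain ⟨h4, h5⟩ := norm_sub_truncation_le hA hN hAN hAk hNk
      rw [← ht]
      constructor <;> linarith
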